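/- Let $n\ge 1$ be an integer, let $\alpha\in(0,2)$ and $\beta>0$, and let $-\pi<\varphi\le\pi$ satisfy $|\varphi|>\pi\alpha/2$. Let $E_{\alpha,\beta}(z)=\sum_{k=0}^{\infty} z^k/\Gamma(\alpha k+\beta)$ be the Mittag-Leffler function and, for $\sigma>0$, consider the function $x\mapsto E_{\alpha,\beta}(e^{i\varphi}|x|^{\sigma})$ on $\mathbb{R}^n$. Then its Fourier transform (in the sense of tempered distributions) is in $L^p(\mathbb{R}^n)$ for all $$2\le p\le\infty\ \text{ if }\ \sigma>n;\qquad 2\le p<\infty\ \text{ if }\ \sigma=n;\qquad 2\le p<\frac{n}{n-\sigma}\ \text{ if }\ \frac n2<\sigma<n.$$ -/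

import Mathlib

open MeasureTheory
open scoped SchwartzMap FourierTransform ENNReal

noncomputable section

/-- The two-parameter Mittag-Leffler function `E_{α,β}(z) = ∑_{k ≥ 0} z ^ k / Γ(α k + β)`. -/
def mittagLeffler (α β : ℝ) (z : ℂ) : ℂ :=
  ∑' k : ℕ, z ^ k / (Real.Gamma (α * k + β) : ℂ)

/-- The function `x ↦ E_{α,β}(e^{iφ} |x|^σ)` on `ℝⁿ`. -/
def mittagLefflerRadial (n : ℕ) (α β φ σ : ℝ) (x : EuclideanSpace ℝ (Fin n)) : ℂ :=
  mittagLeffler α β (Complex.exp (Complex.I * φ) * ((‖x‖ ^ σ : ℝ) : ℂ))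

/-- The tempered distribution `T` is given by integration against the function `f`. -/
def IsGivenByFunction {n : ℕ} (T : 𝓢'(EuclideanSpace ℝ (Fin n), ℂ))
    (f : EuclideanSpace ℝ (Fin n) → ℂ) : Prop :=
  ∀ u : 𝓢(EuclideanSpace ℝ (Fin n), ℂ),
    Integrable (fun x => u x • f x) volume ∧ T u = ∫ x, u x • f x

/-- The function `f` defines a tempered distribution whose Fourier transform (in the sense of
tempered distributions, with the kernel `e^{-2πi⟨x, ξ⟩}`) is a function in `L^p(ℝⁿ)`. -/
def FourierTransformMemLp {n : ℕ} (f : EuclideanSpace ℝ (Fin n) → ℂ) (p : ℝ≥0∞) : Prop :=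
  ∃ T : 𝓢'(EuclideanSpace ℝ (Fin n), ℂ), IsGivenByFunction T f ∧
    ∃ g : EuclideanSpace ℝ (Fin n) → ℂ, IsGivenByFunction (𝓕 T) g ∧ MemLp g p volume

end

/-! The angle condition puts the ray of argument `φ` outside the sector where the Mittag-Leffler
function grows, so E(z) = O(1/|z|) there and f(x) = E(e^{iφ}|x|^σ) is O((1+|x|)^{-σ}). Everything
else follows from this size bound.

Decay. With z = -e^{ρ+iψ} the series is Σ (-1)^k h(k), where h(s) = e^{s(ρ+iψ)}/Γ(αs+b) is entire.
The residue of 1/sin(πs), in the form of a mean value formula on strips of width one, gives 2h(k) =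
I_k + I_{k+1} with I_k = ∫ h(k-1/2+it)/cosh(πt) dt. The alternating sum telescopes to 2E = I_0 =
O(|z|^{-1/2}). Since 1/Γ grows at most like e^{c|Im|} for any c > π/2, these integrals converge when
|ψ| + πα/2 < π, which is the angle condition. The relation E_{α,b-α} = 1/Γ(b-α) + z E_{α,b} improves
the exponent to -1.

Fourier side. As σ > n/2, f is in L², and its Plancherel transform is the distributional one. Cut f
into dyadic annuli: on a set S where |f| ≤ b, interpolating between L¹ → L^∞ and L² → L² bounds the
L^p norm of the transform of that piece by b|S|^{1-1/p}. The pieces have norm O(2^{N(n(1-1/p)-σ)}),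
summable when n(1-1/p) < σ; this is the stated range for finite p. For p = ∞ and σ > n, f is
integrable. -/

/-! ### Growth of 1/Γ in vertical strips. -/

/-- The reflection formula gives |Γ(1+iv)|² = π|v|/sinh(π|v|) for v ≠ 0. -/
theorem Complex.norm_Gamma_one_add_mul_I_inv_le (v : ℝ) :
    ‖(Complex.Gamma (1 + v * Complex.I))⁻¹‖ ≤ Real.exp (Real.pi * |v| / 2) := by
  rcases eq_or_ne v 0 with rfl | hv
  · simp
  have h1 : Complex.Gamma (1 + v * Complex.I) * Complex.Gamma (1 - v * Complex.I)
      = (v * Complex.I) * (Real.pi / Complex.sin (Real.pi * (v * Complex.I))) := by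
    rw [← Complex.Gamma_mul_Gamma_one_sub, add_comm, Complex.Gamma_add_one]
    · ring
    · simp [hv]
  have h2 : Complex.Gamma (1 - v * Complex.I) =
      (starRingEnd ℂ) (Complex.Gamma (1 + v * Complex.I)) := by
    rw [← Complex.Gamma_conj]; congr 1; simp [Complex.ext_iff]
  have h3 : Complex.sin (Real.pi * (v * Complex.I)) = (Real.sinh (Real.pi * v) : ℝ) * Complex.I := by
    rw [← mul_assoc, Complex.sin_mul_I]; push_cast; rfl
  have h4 : ‖Complex.Gamma (1 + v * Complex.I)‖ ^ 2 =
      Real.pi * |v| / Real.sinh (Real.pi * |v|) := by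
    have := congrArg norm h1
    rw [h2, h3] at this
    simp only [norm_mul, RCLike.norm_conj, norm_div, Complex.norm_real, Complex.norm_I, mul_one] at this
    rw [sq, this]
    have e : ‖Real.sinh (Real.pi * v)‖ = Real.sinh (Real.pi * |v|) := by
      rw [Real.norm_eq_abs, Real.abs_sinh, abs_mul, abs_of_pos Real.pi_pos]
    rw [e, Real.norm_eq_abs, Real.norm_eq_abs, abs_of_pos Real.pi_pos]; ring
  set x := Real.pi * |v| with hx
  have hxpos : 0 < x := by positivity
  -- This is 1 - 2x ≤ e^{-2x} multiplied by e^x.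
  have hs : Real.sinh x ≤ x * Real.exp x := by
    have := Real.add_one_le_exp (-2 * x)
    rw [Real.sinh_eq]
    have e : Real.exp (-x) = Real.exp x * Real.exp (-2 * x) := by rw [← Real.exp_add]; ring_nf
    have := mul_le_mul_of_nonneg_left this (Real.exp_pos x).le
    rw [← e] at this; linarith
  have hspos : 0 < Real.sinh x := Real.sinh_pos_iff.2 hxpos
  rw [norm_inv]
  refine abs_le_of_sq_le_sq' ?_ (Real.exp_pos _).le |>.2
  rw [inv_pow, h4, inv_div, div_le_iff₀ hxpos, ← Real.exp_nat_mul]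
  calc _ ≤ _ := hs
    _ = _ := by push_cast; ring_nf

theorem mul_norm_add_mul_I_le {a b : ℝ} (v : ℝ) (ha : 0 ≤ a) (hab : a ≤ b) :
    a * ‖(b + v * Complex.I : ℂ)‖ ≤ b * ‖(a + v * Complex.I : ℂ)‖ := by
  refine abs_le_of_sq_le_sq' ?_ (mul_nonneg (ha.trans hab) (norm_nonneg _)) |>.2
  rw [mul_pow, mul_pow, ← Complex.normSq_eq_norm_sq, ← Complex.normSq_eq_norm_sq,
    Complex.normSq_add_mul_I, Complex.normSq_add_mul_I]
  have : a ^ 2 * v ^ 2 ≤ b ^ 2 * v ^ 2 := by gcongr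
  nlinarith

/-- In Euler's limit, |Γ(u+iv)|/Γ(u) is the product of the factors (u+j)/|u+j+iv|, each increasing
in u; compare with u = 1. -/
theorem Complex.Gamma_mul_norm_Gamma_one_add_le {u : ℝ} (v : ℝ) (hu : 1 ≤ u) :
    Real.Gamma u * ‖Complex.Gamma (1 + v * Complex.I)‖ ≤ ‖Complex.Gamma (u + v * Complex.I)‖ := by
  have t1 := (Real.GammaSeq_tendsto_Gamma u).mul
    (Complex.GammaSeq_tendsto_Gamma (1 + v * Complex.I)).norm
  have t2 := (Real.GammaSeq_tendsto_Gamma 1).mul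
    (Complex.GammaSeq_tendsto_Gamma (u + v * Complex.I)).norm
  rw [Real.Gamma_one, one_mul] at t2
  refine le_of_tendsto_of_tendsto t1 t2 ?_
  filter_upwards [Filter.eventually_ge_atTop 1] with n hn
  have hn0 : 0 < (n : ℝ) := by exact_mod_cast hn
  have key : (∏ j ∈ Finset.range (n + 1), ((1 : ℝ) + j)) *
      ∏ j ∈ Finset.range (n + 1), ‖(u + v * Complex.I + j : ℂ)‖ ≤
      (∏ j ∈ Finset.range (n + 1), (u + j)) *
      ∏ j ∈ Finset.range (n + 1), ‖(1 + v * Complex.I + j : ℂ)‖ := by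
    rw [← Finset.prod_mul_distrib, ← Finset.prod_mul_distrib]
    refine Finset.prod_le_prod (fun _ _ => by positivity) fun j _ => ?_
    have := mul_norm_add_mul_I_le (a := 1 + j) (b := u + j) v (by positivity) (by linarith)
    have e (x : ℝ) : (x + v * Complex.I + j : ℂ) = ((x + j : ℝ) : ℂ) + v * Complex.I := by
      push_cast; ring
    rw [e, ← Complex.ofReal_one, e]
    exact this
  have hp (x : ℝ) (hx : 1 ≤ x) : 0 < ∏ j ∈ Finset.range (n + 1), ‖(x + v * Complex.I + j : ℂ)‖ := by
    refine Finset.prod_pos fun j _ => norm_pos_iff.2 fun h => ?_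
    have := congrArg Complex.re h
    simp at this
    have : (0 : ℝ) ≤ j := by positivity
    linarith
  have hq (x : ℝ) (hx : 1 ≤ x) : 0 < ∏ j ∈ Finset.range (n + 1), (x + j) :=
    Finset.prod_pos fun j _ => by positivity
  simp only [Real.GammaSeq, Complex.GammaSeq, norm_div, norm_mul, norm_prod, Complex.norm_natCast]
  rw [← Complex.ofReal_natCast n, Complex.norm_cpow_eq_rpow_re_of_pos hn0,
    Complex.norm_cpow_eq_rpow_re_of_pos hn0]
  simp only [Complex.add_re, Complex.one_re, Complex.mul_re, Complex.ofReal_re, Complex.I_re,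
    mul_zero, Complex.ofReal_im, Complex.I_im, mul_one, sub_self, add_zero]
  have hp1 := hp 1 le_rfl
  have hpu := hp u hu
  have hq1 := hq 1 le_rfl
  have hqu := hq u hu
  simp only [Complex.ofReal_one] at hp1
  rw [div_mul_div_comm, div_mul_div_comm]
  rw [div_le_div_iff₀ (by positivity) (by positivity)]
  have : 0 ≤ (n : ℝ) ^ u * n.factorial * ((n : ℝ) ^ (1 : ℝ) * n.factorial) := by positivity
  calc _ ≤ _ := mul_le_mul_of_nonneg_left key this
    _ = _ := by ring

theorem Complex.norm_Gamma_inv_le_of_one_le_re {w : ℂ} (hw : 1 ≤ w.re) :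
    ‖(Complex.Gamma w)⁻¹‖ ≤ Real.exp (Real.pi * |w.im| / 2) / Real.Gamma w.re := by
  have h := Complex.Gamma_mul_norm_Gamma_one_add_le w.im hw
  rw [Complex.re_add_im] at h
  have h1 := Complex.norm_Gamma_one_add_mul_I_inv_le w.im
  have hG : 0 < Real.Gamma w.re := Real.Gamma_pos_of_pos (by linarith)
  have h0 : 0 < ‖Complex.Gamma (1 + w.im * Complex.I)‖ :=
    norm_pos_iff.2 (Complex.Gamma_ne_zero_of_re_pos (by simp))
  rw [norm_inv] at h1 ⊢
  calc ‖Complex.Gamma w‖⁻¹ ≤ (Real.Gamma w.re * ‖Complex.Gamma (1 + w.im * Complex.I)‖)⁻¹ := by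
        gcongr
    _ = ‖Complex.Gamma (1 + w.im * Complex.I)‖⁻¹ / Real.Gamma w.re := by
        rw [mul_inv, div_eq_mul_inv, mul_comm]
    _ ≤ _ := by gcongr

/-- Iterating 1/Γ(w) = w/Γ(w+1) moves w into the half-plane Re ≥ 1 at the price of a polynomial
factor. -/
theorem Complex.norm_Gamma_inv_le (m : ℕ) (w : ℂ) (hw : 1 ≤ w.re + m) :
    ‖(Complex.Gamma w)⁻¹‖ ≤
      (‖w‖ + m) ^ m * (Real.exp (Real.pi * |w.im| / 2) / Real.Gamma (w.re + m)) := by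
  induction m generalizing w with
  | zero => simpa using Complex.norm_Gamma_inv_le_of_one_le_re (by simpa using hw)
  | succ m ih =>
    rw [Complex.one_div_Gamma_eq_self_mul_one_div_Gamma_add_one, norm_mul]
    have := ih (w + 1) (by push_cast at hw; simp; linarith)
    simp only [Complex.add_re, Complex.one_re, Complex.add_im, Complex.one_im, add_zero] at this
    have hG : 0 < Real.Gamma (w.re + (m + 1 : ℕ)) := Real.Gamma_pos_of_pos (by linarith)
    have e : w.re + 1 + m = w.re + (m + 1 : ℕ) := by push_cast; ring
    rw [e] at this
    have hn : ‖w + 1‖ ≤ ‖w‖ + 1 := (norm_add_le _ _).trans (by simp)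
    calc _ ≤ (‖w‖ + (m + 1 : ℕ)) * ((‖w‖ + (m + 1 : ℕ)) ^ m *
          (Real.exp (Real.pi * |w.im| / 2) / Real.Gamma (w.re + (m + 1 : ℕ)))) := by
          refine mul_le_mul (by simp; positivity) (this.trans ?_) (norm_nonneg _) (by positivity)
          gcongr ?_ ^ m * _
          push_cast; linarith
      _ = _ := by ring

/-- On a vertical strip, `1 / Γ` grows at most like `exp (c |Im w|)` for every `c > π / 2`. -/
theorem Complex.exists_norm_Gamma_inv_le (A B : ℝ) {c : ℝ} (hc : Real.pi / 2 < c) :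
    ∃ C, 0 ≤ C ∧ ∀ w : ℂ, A ≤ w.re → w.re ≤ B →
      ‖(Complex.Gamma w)⁻¹‖ ≤ C * Real.exp (c * |w.im|) := by
  obtain ⟨m, hm⟩ := exists_nat_ge (1 - A)
  have hcont : Continuous fun x : ℝ => (Complex.Gamma x)⁻¹ :=
    Complex.differentiable_one_div_Gamma.continuous.comp Complex.continuous_ofReal
  obtain ⟨K, hK⟩ := (isCompact_Icc (a := A + m) (b := B + m)).exists_bound_of_continuousOn
    hcont.continuousOn
  set ε := c - Real.pi / 2 with hε
  have hε0 : 0 < ε := by linarith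
  set D := |A| + |B| + m with hD
  have hD0 : 0 ≤ D := by positivity
  refine ⟨(m.factorial / ε ^ m * Real.exp (ε * D)) * |K|, by positivity, fun w h1 h2 => ?_⟩
  have hG : 0 < Real.Gamma (w.re + m) := Real.Gamma_pos_of_pos (by linarith)
  have hKw : (Real.Gamma (w.re + m))⁻¹ ≤ |K| := by
    have := hK (w.re + m) ⟨by linarith, by linarith⟩
    simp only [Complex.Gamma_ofReal, norm_inv, Complex.norm_real, Real.norm_eq_abs,
      abs_of_pos hG] at this
    exact this.trans (le_abs_self _)
  have hw : ‖w‖ + m ≤ D + |w.im| := by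
    have := Complex.norm_le_abs_re_add_abs_im w
    have : |w.re| ≤ |A| + |B| := by
      rw [abs_le]
      constructor <;> linarith [neg_abs_le A, le_abs_self B, abs_nonneg A, abs_nonneg B]
    linarith
  -- The margin ε = c - π/2 absorbs the polynomial factor, through y^m/m! ≤ e^y.
  have hpow : (‖w‖ + m) ^ m ≤ m.factorial / ε ^ m * (Real.exp (ε * D) * Real.exp (ε * |w.im|)) := by
    have := Real.pow_div_factorial_le_exp (ε * (D + |w.im|)) (by positivity) m
    rw [div_le_iff₀ (by positivity), mul_pow] at this
    rw [← Real.exp_add, ← mul_add, div_mul_eq_mul_div, le_div_iff₀ (by positivity)]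
    calc _ ≤ (D + |w.im|) ^ m * ε ^ m := by gcongr
      _ ≤ _ := by linarith
  calc _ ≤ _ := Complex.norm_Gamma_inv_le m w (by linarith)
    _ = (‖w‖ + m) ^ m * (Real.exp (Real.pi * |w.im| / 2) * (Real.Gamma (w.re + m))⁻¹) := by
        rw [div_eq_mul_inv]
    _ ≤ (m.factorial / ε ^ m * (Real.exp (ε * D) * Real.exp (ε * |w.im|))) *
        (Real.exp (Real.pi * |w.im| / 2) * |K|) := by gcongr
    _ = (m.factorial / ε ^ m * Real.exp (ε * D)) * |K| *
        (Real.exp (ε * |w.im|) * Real.exp (Real.pi * |w.im| / 2)) := by ring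
    _ = _ := by
        rw [← Real.exp_add]; congr 2; rw [hε]; ring

/-! ### Convergence of the series. -/

/-- Keep only the part of Euler's integral over (R, R+1]. As R is free, Γ beats every exponential.
-/
theorem Real.rpow_mul_exp_le_Gamma {R x : ℝ} (hR : 0 ≤ R) (hx : 1 ≤ x) :
    R ^ (x - 1) * Real.exp (-(R + 1)) ≤ Real.Gamma x := by
  rw [Real.Gamma_eq_integral (by linarith)]
  have hint := Real.GammaIntegral_convergent (s := x) (by linarith)
  have hsub : Set.Ioc R (R + 1) ⊆ Set.Ioi 0 := fun t ht => hR.trans_lt ht.1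
  calc R ^ (x - 1) * Real.exp (-(R + 1))
      = ∫ t in Set.Ioc R (R + 1), R ^ (x - 1) * Real.exp (-(R + 1)) := by simp
    _ ≤ ∫ t in Set.Ioc R (R + 1), Real.exp (-t) * t ^ (x - 1) := by
        refine setIntegral_mono_on (integrableOn_const measure_Ioc_lt_top.ne) (hint.mono_set hsub) measurableSet_Ioc fun t ht => ?_
        rw [mul_comm]
        gcongr
        · exact ht.2
        · exact ht.1.le
    _ ≤ _ := setIntegral_mono_set hint
        (by filter_upwards [self_mem_ae_restrict measurableSet_Ioi] with t ht
            have : (0 : ℝ) < t := ht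
            simp only [Pi.zero_apply]; positivity)
        hsub.eventuallyLE

theorem summable_pow_mul_Gamma_inv {α : ℝ} (hα : 0 < α) (b : ℝ) {r : ℝ} (hr : 0 ≤ r) :
    Summable fun k : ℕ => r ^ k * |Real.Gamma (α * k + b)|⁻¹ := by
  -- Chosen so that R^α = 2(r+1), which leaves a geometric majorant of ratio 1/2; r+1 keeps R
  -- positive when r = 0.
  set R := (2 * (r + 1)) ^ (α⁻¹) with hR
  have hR0 : 0 < R := by positivity
  have hRα : R ^ α = 2 * (r + 1) := by
    rw [hR, ← Real.rpow_mul (by positivity), inv_mul_cancel₀ hα.ne', Real.rpow_one]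
  refine Summable.of_norm_bounded_eventually_nat
    (g := fun k : ℕ => (R ^ (b - 1) * Real.exp (-(R + 1)))⁻¹ * (1 / 2) ^ k)
    ((summable_geometric_of_lt_one (by norm_num) (by norm_num)).mul_left _) ?_
  have hev : ∀ᶠ k : ℕ in Filter.atTop, 1 ≤ α * k + b := by
    have : Filter.Tendsto (fun k : ℕ => α * k + b) Filter.atTop Filter.atTop :=
      Filter.tendsto_atTop_add_const_right _ _
        ((tendsto_natCast_atTop_atTop).const_mul_atTop hα)
    exact this.eventually_ge_atTop 1
  filter_upwards [hev] with k hk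
  have hG := Real.rpow_mul_exp_le_Gamma hR0.le hk
  have hGp : 0 < Real.Gamma (α * k + b) := Real.Gamma_pos_of_pos (by linarith)
  rw [Real.norm_eq_abs, abs_of_nonneg (by positivity), abs_of_pos hGp]
  have e : R ^ (α * k + b - 1) = (2 * (r + 1)) ^ k * R ^ (b - 1) := by
    rw [add_sub_assoc, Real.rpow_add hR0, Real.rpow_mul hR0.le, hRα, Real.rpow_natCast]
  rw [e, mul_assoc] at hG
  set c := R ^ (b - 1) * Real.exp (-(R + 1)) with hc
  have hc0 : 0 < c := by positivity
  calc r ^ k * (Real.Gamma (α * k + b))⁻¹ ≤ (r + 1) ^ k * ((2 * (r + 1)) ^ k * c)⁻¹ := by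
        gcongr; linarith
    _ = _ := by
        rw [mul_pow, one_div, inv_pow]
        have : (r + 1) ^ k ≠ 0 := by positivity
        field_simp

/-! ### The kernel 1/cosh(πt) and the mean value formula on a strip. -/

theorem Real.integrable_exp_neg_mul_abs {c : ℝ} (hc : 0 < c) :
    Integrable fun t : ℝ => Real.exp (-(c * |t|)) := by
  refine (integrable_inv_one_add_sq.const_mul (1 + 2 / c ^ 2)).mono'
    (by fun_prop) (ae_of_all _ fun t => ?_)
  rw [Real.norm_eq_abs, abs_of_pos (Real.exp_pos _), Real.exp_neg, ← div_eq_mul_inv,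
    le_div_iff₀ (by positivity), inv_mul_le_iff₀ (Real.exp_pos _)]
  have h1 := Real.pow_div_factorial_le_exp (c * |t|) (by positivity) 2
  have h2 : 1 ≤ Real.exp (c * |t|) := Real.one_le_exp (by positivity)
  rw [mul_pow, sq_abs] at h1
  have h3 : t ^ 2 ≤ 2 / c ^ 2 * Real.exp (c * |t|) := by
    rw [div_mul_eq_mul_div, le_div_iff₀ (by positivity)]
    norm_num [Nat.factorial] at h1
    linarith
  linarith

theorem Real.exp_mul_abs_div_cosh_le (a t : ℝ) :
    Real.exp (a * |t|) / Real.cosh (Real.pi * t) ≤ 2 * Real.exp (-((Real.pi - a) * |t|)) := by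
  rw [div_le_iff₀ (Real.cosh_pos _), ← Real.cosh_abs, abs_mul, abs_of_pos Real.pi_pos,
    Real.cosh_eq]
  have e : Real.exp (a * |t|) = Real.exp (-((Real.pi - a) * |t|)) * Real.exp (Real.pi * |t|) := by
    rw [← Real.exp_add]; congr 1; ring
  have : 0 ≤ Real.exp (-((Real.pi - a) * |t|)) * Real.exp (-(Real.pi * |t|)) := by positivity
  rw [e]; linarith

theorem Real.integrable_exp_mul_abs_div_cosh {a : ℝ} (ha : a < Real.pi) :
    Integrable fun t : ℝ => Real.exp (a * |t|) / Real.cosh (Real.pi * t) := by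
  refine ((Real.integrable_exp_neg_mul_abs (sub_pos.2 ha)).const_mul 2).mono'
    (Continuous.aestronglyMeasurable ?_) (ae_of_all _ fun t => ?_)
  · exact Continuous.div (by fun_prop) (by fun_prop) fun t => (Real.cosh_pos _).ne'
  · rw [Real.norm_eq_abs, abs_of_pos (div_pos (Real.exp_pos _) (Real.cosh_pos _))]
    exact Real.exp_mul_abs_div_cosh_le a t

theorem Real.integral_inv_cosh_pi_mul : ∫ t : ℝ, (Real.cosh (Real.pi * t))⁻¹ = 1 := by
  have hint : Integrable fun t : ℝ => (Real.cosh (Real.pi * t))⁻¹ := by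
    simpa using Real.integrable_exp_mul_abs_div_cosh (a := 0) Real.pi_pos
  have hd (t : ℝ) : HasDerivAt (fun t => Real.pi⁻¹ * Real.arctan (Real.sinh (Real.pi * t)))
      (Real.cosh (Real.pi * t))⁻¹ t := by
    have h1 : HasDerivAt (fun t : ℝ => Real.pi * t) Real.pi t := by
      simpa using (hasDerivAt_id t).const_mul Real.pi
    refine ((h1.sinh.arctan).const_mul Real.pi⁻¹).congr_deriv ?_
    have hc := (Real.cosh_pos (Real.pi * t)).ne'
    have : 1 + Real.sinh (Real.pi * t) ^ 2 = Real.cosh (Real.pi * t) ^ 2 := by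
      rw [Real.cosh_sq]; ring
    rw [this]
    field_simp
  have htop : Filter.Tendsto (fun t => Real.pi⁻¹ * Real.arctan (Real.sinh (Real.pi * t)))
      Filter.atTop (nhds (Real.pi⁻¹ * (Real.pi / 2))) := by
    refine Filter.Tendsto.const_mul _ ?_
    refine (Real.tendsto_arctan_atTop.mono_right nhdsWithin_le_nhds).comp ?_
    refine Real.sinhOrderIso.tendsto_atTop.comp ?_
    exact Filter.tendsto_id.const_mul_atTop Real.pi_pos
  have hbot : Filter.Tendsto (fun t => Real.pi⁻¹ * Real.arctan (Real.sinh (Real.pi * t)))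
      Filter.atBot (nhds (Real.pi⁻¹ * (-(Real.pi / 2)))) := by
    refine Filter.Tendsto.const_mul _ ?_
    refine (Real.tendsto_arctan_atBot.mono_right nhdsWithin_le_nhds).comp ?_
    refine Real.sinhOrderIso.tendsto_atBot.comp ?_
    exact Filter.tendsto_id.const_mul_atBot Real.pi_pos
  rw [integral_of_hasDerivAt_of_tendsto hd hint hbot htop]
  field_simp
  ring

theorem Complex.abs_sinh_le_norm_sin (x y : ℝ) :
    |Real.sinh y| ≤ ‖Complex.sin (x + y * Complex.I)‖ := by
  refine abs_le_of_sq_le_sq (b := ‖Complex.sin (x + y * Complex.I)‖) ?_ (norm_nonneg _)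
  rw [Complex.sin_add_mul_I, ← Complex.ofReal_sin, ← Complex.ofReal_cos, ← Complex.ofReal_cosh,
    ← Complex.ofReal_sinh, ← Complex.ofReal_mul, ← Complex.ofReal_mul,
    ← Complex.normSq_eq_norm_sq, Complex.normSq_add_mul_I, mul_pow, mul_pow, Real.cosh_sq]
  nlinarith [Real.sin_sq_add_cos_sq x, sq_nonneg (Real.sin x)]

theorem Complex.sin_pi_mul_half_add (t : ℝ) :
    Complex.sin (Real.pi * (1 / 2 + t * Complex.I)) = Real.cosh (Real.pi * t) := by
  have : (Real.pi * (1 / 2 + t * Complex.I) : ℂ) = (Real.pi / 2 : ℂ) + (Real.pi * t : ℂ) * Complex.I := by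
    ring
  rw [this, Complex.sin_add_mul_I, Complex.sin_pi_div_two, Complex.cos_pi_div_two]
  simp

theorem Complex.sin_pi_mul_neg_half_add (t : ℝ) :
    Complex.sin (Real.pi * (-1 / 2 + t * Complex.I)) = -Real.cosh (Real.pi * t) := by
  have : (Real.pi * (-1 / 2 + t * Complex.I) : ℂ) =
      -(Real.pi * (1 / 2 + (-t : ℝ) * Complex.I)) := by
    push_cast; ring
  rw [this, Complex.sin_neg, Complex.sin_pi_mul_half_add]
  simp

theorem Complex.sin_pi_mul_ne_zero {s : ℂ} (hs : s ≠ 0) (h : |s.re| < 1) :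
    Complex.sin (Real.pi * s) ≠ 0 := by
  rw [Complex.sin_ne_zero_iff]
  intro k hk
  rw [mul_comm] at hk
  have hk' : s = k := mul_right_cancel₀ (by exact_mod_cast Real.pi_ne_zero) hk
  rw [hk'] at h hs
  simp only [Complex.intCast_re] at h
  have : |k| < 1 := by exact_mod_cast h
  rw [Int.abs_lt_one_iff] at this
  exact hs (by simp [this])

theorem Complex.integrable_div_cosh {g : ℝ → ℂ} (hg : Continuous g) {C a : ℝ} (ha : a < Real.pi)
    (hb : ∀ t, ‖g t‖ ≤ C * Real.exp (a * |t|)) :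
    Integrable fun t : ℝ => g t / (Real.cosh (Real.pi * t) : ℂ) := by
  refine ((Real.integrable_exp_mul_abs_div_cosh ha).const_mul C).mono'
    (Continuous.aestronglyMeasurable ?_) (ae_of_all _ fun t => ?_)
  · refine hg.div (by fun_prop) fun t => ?_
    exact_mod_cast (Real.cosh_pos _).ne'
  · rw [norm_div, Complex.norm_real, Real.norm_eq_abs, abs_of_pos (Real.cosh_pos _), ← mul_div_assoc]
    have := (Real.cosh_pos (Real.pi * t)).le
    gcongr
    exact hb t

/-- Cauchy's theorem for h(s)/sin(πs) on |Re s| ≤ 1/2: the zero of h removes the pole, sin(πs) =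
±cosh(πt) on the vertical sides, and |sin(πs)| ≥ sinh(π|T|) makes the horizontal sides vanish since
a < π. -/
theorem Complex.integral_strip_div_cosh_of_zero {h : ℂ → ℂ} (hh : Differentiable ℂ h) (h0 : h 0 = 0)
    {C a : ℝ} (ha : a < Real.pi)
    (hb : ∀ x t : ℝ, |x| ≤ 1 / 2 → ‖h (x + t * Complex.I)‖ ≤ C * Real.exp (a * |t|)) :
    ∫ t : ℝ, (h (1 / 2 + t * Complex.I) + h (-1 / 2 + t * Complex.I)) /
      (Real.cosh (Real.pi * t) : ℂ) = 0 := by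
  set q : ℂ → ℂ := fun s => Complex.sin (Real.pi * s) with hq
  have hqd : Differentiable ℂ q := by fun_prop
  -- The quotient of divided differences is h/q away from 0 and supplies its holomorphic extension
  -- at 0.
  set f : ℂ → ℂ := fun s => dslope h 0 s / dslope q 0 s with hf
  have hfeq {s : ℂ} (hs : s ≠ 0) : f s = h s / q s := by
    have : q 0 = 0 := by simp [hq]
    simp only [hf, dslope_of_ne _ hs, slope_def_field, h0, this, sub_zero]
    field_simp
  have hq0 {s : ℂ} (h : |s.re| < 1) : dslope q 0 s ≠ 0 := by
    rcases eq_or_ne s 0 with rfl | hs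
    · rw [dslope_same]
      have : HasDerivAt q (Complex.cos (Real.pi * 0) * Real.pi) 0 := by
        have : HasDerivAt (fun s : ℂ => (Real.pi : ℂ) * s) Real.pi 0 := by
          simpa using (hasDerivAt_id (0 : ℂ)).const_mul (Real.pi : ℂ)
        exact this.csin
      rw [this.deriv]
      simp [Real.pi_ne_zero]
    · have : q 0 = 0 := by simp [hq]
      rw [dslope_of_ne _ hs, slope_def_field, this, sub_zero, sub_zero]
      exact div_ne_zero (Complex.sin_pi_mul_ne_zero hs h) hs
  have hfd (s : ℂ) (hs : |s.re| < 1) : DifferentiableAt ℂ f s := by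
    have h1 : Differentiable ℂ (dslope h 0) := by
      rw [← differentiableOn_univ, Complex.differentiableOn_dslope Filter.univ_mem]
      exact hh.differentiableOn
    have h2 : Differentiable ℂ (dslope q 0) := by
      rw [← differentiableOn_univ, Complex.differentiableOn_dslope Filter.univ_mem]
      exact hqd.differentiableOn
    exact (h1 s).div (h2 s) (hq0 hs)
  have hright (t : ℝ) : f (1 / 2 + t * Complex.I) =
      h (1 / 2 + t * Complex.I) / (Real.cosh (Real.pi * t) : ℂ) := by
    rw [hfeq]; simp only [hq]; rw [Complex.sin_pi_mul_half_add]
    intro H; have := congrArg Complex.re H; norm_num at this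
  have hleft (t : ℝ) : f (-1 / 2 + t * Complex.I) =
      -(h (-1 / 2 + t * Complex.I) / (Real.cosh (Real.pi * t) : ℂ)) := by
    rw [hfeq]; simp only [hq]; rw [Complex.sin_pi_mul_neg_half_add, div_neg]
    intro H; have := congrArg Complex.re H; norm_num at this
  have hbr (t : ℝ) : ‖h (1 / 2 + t * Complex.I)‖ ≤ C * Real.exp (a * |t|) := by
    simpa using hb (1 / 2) t (by norm_num [abs_of_pos])
  have hbl (t : ℝ) : ‖h (-1 / 2 + t * Complex.I)‖ ≤ C * Real.exp (a * |t|) := by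
    simpa using hb (-1 / 2) t (by norm_num [abs_of_pos])
  have hc := hh.continuous
  have hir := Complex.integrable_div_cosh (g := fun t => h (1 / 2 + t * Complex.I))
    (by fun_prop) ha hbr
  have hil := Complex.integrable_div_cosh (g := fun t => h (-1 / 2 + t * Complex.I))
    (by fun_prop) ha hbl
  have hC : 0 ≤ C := by simpa using (norm_nonneg _).trans (hbr 0)
  have hhor (T : ℝ) (hT : 0 < |T|) : ‖∫ x : ℝ in (-1 / 2)..(1 / 2), f (x + T * Complex.I)‖ ≤
      C * (Real.exp (a * |T|) / Real.sinh (Real.pi * |T|)) := by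
    have := intervalIntegral.norm_integral_le_of_norm_le_const (a := -1 / 2) (b := 1 / 2)
      (f := fun x : ℝ => f (x + T * Complex.I))
      (C := C * (Real.exp (a * |T|) / Real.sinh (Real.pi * |T|))) fun x hx => ?_
    · norm_num at this ⊢; exact this
    · have hx' : |x| ≤ 1 / 2 := by
        rw [Set.uIoc_of_le (by norm_num)] at hx
        rw [abs_le]; constructor <;> linarith [hx.1, hx.2]
      have hne : (x + T * Complex.I : ℂ) ≠ 0 := by
        intro H; have := congrArg Complex.im H
        simp at this
        simp [this] at hT
      have hs : 0 < Real.sinh (Real.pi * |T|) := Real.sinh_pos_iff.2 (by positivity)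
      have hsin : Real.sinh (Real.pi * |T|) ≤ ‖q (x + T * Complex.I)‖ := by
        have := Complex.abs_sinh_le_norm_sin (Real.pi * x) (Real.pi * T)
        rw [Real.abs_sinh, abs_mul, abs_of_pos Real.pi_pos] at this
        convert this using 3
        push_cast; ring
      rw [hfeq hne, norm_div, ← mul_div_assoc]
      gcongr
      exact hb x T hx'
  have hlim0 : Filter.Tendsto (fun T : ℝ => C * (Real.exp (a * |T|) / Real.sinh (Real.pi * |T|)))
      Filter.atTop (nhds 0) := by
    rw [← mul_zero C]
    refine Filter.Tendsto.const_mul _ ?_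
    have hbd : Filter.Tendsto (fun T : ℝ => 4 * Real.exp (-((Real.pi - a) * T))) Filter.atTop
        (nhds 0) := by
      rw [← mul_zero 4]
      refine Filter.Tendsto.const_mul _ ?_
      refine Real.tendsto_exp_neg_atTop_nhds_zero.comp ?_
      exact Filter.tendsto_id.const_mul_atTop (sub_pos.2 ha)
    refine tendsto_of_tendsto_of_tendsto_of_le_of_le' tendsto_const_nhds hbd ?_ ?_
    · filter_upwards with T
      exact div_nonneg (Real.exp_pos _).le (Real.sinh_nonneg_iff.2 (by positivity))
    · filter_upwards [Filter.eventually_ge_atTop 1] with T hT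
      have hT0 : 0 < T := by linarith
      rw [abs_of_pos hT0, div_le_iff₀ (Real.sinh_pos_iff.2 (by positivity)), Real.sinh_eq]
      have e : Real.exp (a * T) = Real.exp (-((Real.pi - a) * T)) * Real.exp (Real.pi * T) := by
        rw [← Real.exp_add]; congr 1; ring
      have h2 : Real.exp (-(Real.pi * T)) ≤ Real.exp (Real.pi * T) / 2 := by
        rw [le_div_iff₀ two_pos, Real.exp_neg, inv_mul_le_iff₀ (Real.exp_pos _)]
        have := Real.add_one_le_exp (Real.pi * T)
        have : 1 ≤ Real.pi * T := by nlinarith [Real.pi_gt_three]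
        nlinarith
      rw [e]
      have h3 := Real.exp_pos (-((Real.pi - a) * T))
      nlinarith
  have hrect (T : ℝ) : (∫ x : ℝ in (-1 / 2)..(1 / 2), f (x + (-T : ℝ) * Complex.I)) -
      (∫ x : ℝ in (-1 / 2)..(1 / 2), f (x + T * Complex.I)) +
      Complex.I • (∫ t : ℝ in (-T)..T, (h (1 / 2 + t * Complex.I) + h (-1 / 2 + t * Complex.I)) /
        (Real.cosh (Real.pi * t) : ℂ)) = 0 := by
    have := Complex.integral_boundary_rect_eq_zero_of_differentiableOn f (⟨-1 / 2, -T⟩ : ℂ)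
      (⟨1 / 2, T⟩ : ℂ) fun s hs => (hfd s ?_).differentiableWithinAt
    · simp only [] at this
      rw [← this]
      have e : (∫ t : ℝ in (-T)..T, (h (1 / 2 + t * Complex.I) + h (-1 / 2 + t * Complex.I)) /
          (Real.cosh (Real.pi * t) : ℂ)) = (∫ t : ℝ in (-T)..T, f (1 / 2 + t * Complex.I)) -
          ∫ t : ℝ in (-T)..T, f (-1 / 2 + t * Complex.I) := by
        simp only [hright, hleft]
        rw [intervalIntegral.integral_neg, sub_neg_eq_add,
          ← intervalIntegral.integral_add hir.intervalIntegrable hil.intervalIntegrable]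
        simp only [add_div]
      rw [e, smul_sub, add_sub_assoc]
      norm_num
    · rw [Complex.mem_reProdIm] at hs
      have := hs.1
      simp only [] at this
      rw [Set.uIcc_of_le (by norm_num)] at this
      rw [abs_lt]; constructor <;> linarith [this.1, this.2]
  have hint : Integrable fun t : ℝ => (h (1 / 2 + t * Complex.I) + h (-1 / 2 + t * Complex.I)) /
      (Real.cosh (Real.pi * t) : ℂ) := by
    simp only [add_div]
    exact hir.add hil
  have hlim1 := intervalIntegral_tendsto_integral hint Filter.tendsto_neg_atTop_atBot
    Filter.tendsto_id
  have hlim2 : Filter.Tendsto (fun T : ℝ => ∫ t : ℝ in (-T)..T,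
      (h (1 / 2 + t * Complex.I) + h (-1 / 2 + t * Complex.I)) / (Real.cosh (Real.pi * t) : ℂ))
      Filter.atTop (nhds 0) := by
    refine squeeze_zero_norm' ?_ (by simpa using hlim0.add hlim0)
    filter_upwards [Filter.eventually_gt_atTop 0] with T hT
    have h1 := hhor T (by positivity)
    have h2 := hhor (-T) (by simpa using hT.ne')
    rw [abs_neg] at h2
    have e := eq_neg_of_add_eq_zero_right (hrect T)
    have := congrArg norm e
    rw [norm_smul, Complex.norm_I, one_mul, norm_neg] at this
    rw [this]
    exact (norm_sub_le _ _).trans (add_le_add h2 h1)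
  exact tendsto_nhds_unique hlim1 hlim2

/-- The value of an entire function at `0` is the average of its values on the lines `re s = ±1/2`
against the harmonic measure of the strip. -/
theorem Complex.integral_strip_div_cosh {h : ℂ → ℂ} (hh : Differentiable ℂ h)
    {C a : ℝ} (ha0 : 0 ≤ a) (ha : a < Real.pi)
    (hb : ∀ x t : ℝ, |x| ≤ 1 / 2 → ‖h (x + t * Complex.I)‖ ≤ C * Real.exp (a * |t|)) :
    (∫ t : ℝ, h (-1 / 2 + t * Complex.I) / (Real.cosh (Real.pi * t) : ℂ)) +
      ∫ t : ℝ, h (1 / 2 + t * Complex.I) / (Real.cosh (Real.pi * t) : ℂ) = 2 * h 0 := by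
  -- The subtracted constant contributes 2h(0), because the kernel has total mass 1.
  have key := Complex.integral_strip_div_cosh_of_zero (h := fun s => h s - h 0)
    (hh.sub_const _) (by simp) (C := C + ‖h 0‖) ha fun x t hx => by
      refine (norm_sub_le _ _).trans ?_
      rw [add_mul]
      gcongr
      · exact hb x t hx
      · exact le_mul_of_one_le_right (norm_nonneg _) (Real.one_le_exp (by positivity))
  have hc := hh.continuous
  have hir := Complex.integrable_div_cosh (g := fun t => h (1 / 2 + t * Complex.I))
    (by fun_prop) ha fun t => by simpa using hb (1 / 2) t (by norm_num [abs_of_pos])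
  have hil := Complex.integrable_div_cosh (g := fun t => h (-1 / 2 + t * Complex.I))
    (by fun_prop) ha fun t => by simpa using hb (-1 / 2) t (by norm_num [abs_of_pos])
  have hcosh : Integrable fun t : ℝ => ((Real.cosh (Real.pi * t))⁻¹ : ℝ) := by
    simpa using Real.integrable_exp_mul_abs_div_cosh (a := 0) Real.pi_pos
  have hone : ∫ t : ℝ, 2 * h 0 * (((Real.cosh (Real.pi * t))⁻¹ : ℝ) : ℂ) = 2 * h 0 := by
    rw [integral_const_mul, integral_complex_ofReal, Real.integral_inv_cosh_pi_mul]
    simp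
  have hsum : Integrable fun t : ℝ => h (-1 / 2 + t * Complex.I) / (Real.cosh (Real.pi * t) : ℂ) +
      h (1 / 2 + t * Complex.I) / (Real.cosh (Real.pi * t) : ℂ) := hil.add hir
  have hconst : Integrable fun t : ℝ => 2 * h 0 * (((Real.cosh (Real.pi * t))⁻¹ : ℝ) : ℂ) :=
    hcosh.ofReal.const_mul _
  rw [← hone, ← integral_add hil hir, ← sub_eq_zero, ← integral_sub hsum hconst]
  refine Eq.trans ?_ key
  refine integral_congr_ae (ae_of_all _ fun t => ?_)
  simp only [Complex.ofReal_inv, div_eq_mul_inv]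
  ring

/-- The strip formula centred at k writes 2h(k) as a sum of two line integrals; neighbouring strips
share a line, so the alternating sum telescopes. -/
theorem Complex.two_mul_alternating_sum_eq {h : ℂ → ℂ} (hh : Differentiable ℂ h)
    {a : ℝ} (ha0 : 0 ≤ a) (ha : a < Real.pi)
    (hb : ∀ k : ℕ, ∃ C, ∀ x t : ℝ, |x| ≤ 1 / 2 →
      ‖h (k + x + t * Complex.I)‖ ≤ C * Real.exp (a * |t|)) (N : ℕ) :
    2 * ∑ k ∈ Finset.range N, (-1) ^ k * h k =
      (∫ t : ℝ, h (-1 / 2 + t * Complex.I) / (Real.cosh (Real.pi * t) : ℂ)) -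
      (-1) ^ N * ∫ t : ℝ, h (N - 1 / 2 + t * Complex.I) / (Real.cosh (Real.pi * t) : ℂ) := by
  induction N with
  | zero => simp [neg_div]
  | succ N ih =>
    obtain ⟨C, hC⟩ := hb N
    have := Complex.integral_strip_div_cosh (h := fun s => h (N + s)) (C := C)
      (hh.comp (by fun_prop)) ha0 ha fun x t hx => by
        simpa only [add_assoc] using hC x t hx
    rw [Finset.sum_range_succ, mul_add, ih, pow_succ]
    have e1 (t : ℝ) : (N + (-1 / 2 + t * Complex.I) : ℂ) = N - 1 / 2 + t * Complex.I := by ring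
    have e2 (t : ℝ) : (N + (1 / 2 + t * Complex.I) : ℂ) =
        (N + 1 : ℕ) - 1 / 2 + t * Complex.I := by push_cast; ring
    simp only [e1, e2, add_zero] at this
    linear_combination (-(-1) ^ N) * this

/-! ### Decay of the Mittag-Leffler function along rays. -/

theorem summable_mittagLeffler {α : ℝ} (hα : 0 < α) (b : ℝ) (z : ℂ) :
    Summable fun k : ℕ => z ^ k / (Real.Gamma (α * k + b) : ℂ) := by
  refine Summable.of_norm ?_
  simpa [div_eq_mul_inv] using summable_pow_mul_Gamma_inv hα b (norm_nonneg z)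

theorem mittagLeffler_sub {α : ℝ} (hα : 0 < α) (b : ℝ) (z : ℂ) :
    mittagLeffler α (b - α) z =
      ((Real.Gamma (b - α) : ℂ))⁻¹ + z * mittagLeffler α b z := by
  rw [mittagLeffler, (summable_mittagLeffler hα _ z).tsum_eq_zero_add, mittagLeffler,
    ← tsum_mul_left]
  congr 1
  · simp
  · refine tsum_congr fun k => ?_
    have : α * ((k + 1 : ℕ) : ℝ) + (b - α) = α * k + b := by push_cast; ring
    rw [this, pow_succ]
    ring

theorem Complex.norm_exp_mul_le (x t ρ ψ : ℝ) :
    ‖Complex.exp ((x + t * Complex.I) * (ρ + ψ * Complex.I))‖ ≤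
      Real.exp (x * ρ) * Real.exp (|ψ| * |t|) := by
  rw [Complex.norm_exp, ← Real.exp_add]
  refine Real.exp_le_exp.2 ?_
  have : -(t * ψ) ≤ |ψ| * |t| := by
    rw [← abs_mul, mul_comm t]; exact neg_le_abs _
  simp
  linarith

theorem exists_norm_mittagLeffler_le_exp_neg_half {α ψ : ℝ} (hα : 0 < α) (b : ℝ)
    (hψ : |ψ| + Real.pi * α / 2 < Real.pi) :
    ∃ K, ∀ ρ : ℝ, ‖mittagLeffler α b (-Complex.exp (ρ + ψ * Complex.I))‖ ≤
      K * Real.exp (-ρ / 2) := by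
  -- The midpoint of the admissible interval: c > π/2 is needed for the growth of 1/Γ, and αc < π -
  -- |ψ| for integrability against 1/cosh(πt).
  set c := (Real.pi / 2 + (Real.pi - |ψ|) / α) / 2 with hc
  have hc0 : Real.pi / 2 < (Real.pi - |ψ|) / α := by
    rw [lt_div_iff₀ hα]; linarith
  have hc1 : Real.pi / 2 < c := by rw [hc]; linarith
  have hc2 : α * c < Real.pi - |ψ| := by
    rw [mul_comm, ← lt_div_iff₀ hα, hc]; linarith
  have hcpos : 0 < c := by linarith [Real.pi_pos]
  set a := |ψ| + α * c with ha
  have ha0 : 0 ≤ a := by positivity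
  have haπ : a < Real.pi := by linarith
  -- C depends on k but not on ρ; the strip k = 0 gives the final bound.
  have hstrip (k : ℕ) : ∃ C, 0 ≤ C ∧ ∀ x t ρ : ℝ, |x| ≤ 1 / 2 →
      ‖Complex.exp ((k + x + t * Complex.I) * (ρ + ψ * Complex.I)) *
        (Complex.Gamma (α * (k + x + t * Complex.I) + b))⁻¹‖ ≤
      Real.exp ((k + x) * ρ) * (C * Real.exp (a * |t|)) := by
    obtain ⟨C, hC, h⟩ := Complex.exists_norm_Gamma_inv_le (α * (k - 1 / 2) + b)
      (α * (k + 1 / 2) + b) hc1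
    refine ⟨C, hC, fun x t ρ hx => ?_⟩
    rw [abs_le] at hx
    have h1 := h (α * (k + x + t * Complex.I) + b) (by simp; nlinarith) (by simp; nlinarith)
    have h2 := Complex.norm_exp_mul_le (k + x) t ρ ψ
    push_cast at h2
    have him : (α * (k + x + t * Complex.I) + b : ℂ).im = α * t := by simp
    rw [him, abs_mul, abs_of_pos hα] at h1
    rw [norm_mul]
    calc _ ≤ _ := mul_le_mul h2 h1 (norm_nonneg _) (by positivity)
      _ = Real.exp ((k + x) * ρ) *
          (C * (Real.exp (|ψ| * |t|) * Real.exp (c * (α * |t|)))) := by ring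
      _ = _ := by rw [← Real.exp_add, ha]; ring_nf
  obtain ⟨C, hC, hCb⟩ := hstrip 0
  refine ⟨C * (∫ t : ℝ, Real.exp (a * |t|) / Real.cosh (Real.pi * t)) / 2, fun ρ => ?_⟩
  set h : ℂ → ℂ := fun s => Complex.exp (s * (ρ + ψ * Complex.I)) *
    (Complex.Gamma (α * s + b))⁻¹ with hh
  have hd : Differentiable ℂ h := by
    refine Differentiable.mul (by fun_prop) ?_
    exact Complex.differentiable_one_div_Gamma.comp (by fun_prop)
  -- This also holds at the poles of Γ: there Γ takes the value 0 and 0⁻¹ = 0 is the value of the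
  -- entire function 1/Γ. Hence b may be any real number.
  have hterm (k : ℕ) : (-Complex.exp (ρ + ψ * Complex.I)) ^ k / (Real.Gamma (α * k + b) : ℂ) =
      (-1) ^ k * h k := by
    rw [hh, neg_pow, ← Complex.exp_nat_mul, ← Complex.Gamma_ofReal]
    push_cast
    ring
  have hsum := Complex.two_mul_alternating_sum_eq hd ha0 haπ fun k => by
    obtain ⟨C, hC, h⟩ := hstrip k
    refine ⟨Real.exp ((k + 1 / 2) * |ρ|) * C, fun x t hx => (h x t ρ hx).trans ?_⟩
    rw [← mul_assoc]
    refine mul_le_mul_of_nonneg_right (mul_le_mul_of_nonneg_right (Real.exp_le_exp.2 ?_) hC)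
      (Real.exp_pos _).le
    have h1 : (k + x) * ρ ≤ |k + x| * |ρ| := by rw [← abs_mul]; exact le_abs_self _
    have h2 : |k + x| ≤ k + 1 / 2 := by
      rw [abs_le] at hx ⊢
      have : (0 : ℝ) ≤ k := k.cast_nonneg
      constructor <;> linarith
    exact h1.trans (by gcongr)
  have hI := Real.integrable_exp_mul_abs_div_cosh haπ
  -- Decay in N is needed, so the bound with explicit denominator Γ(αN + b - α/2) replaces the strip
  -- constants.
  have htail : Filter.Tendsto (fun N : ℕ => ∫ t : ℝ, h (N - 1 / 2 + t * Complex.I) /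
      (Real.cosh (Real.pi * t) : ℂ)) Filter.atTop (nhds 0) := by
    have hlim := ((summable_pow_mul_Gamma_inv hα (b - α / 2)
      (Real.exp_pos ρ).le).tendsto_atTop_zero.const_mul (Real.exp (-ρ / 2))).mul_const
      (∫ t : ℝ, Real.exp (a * |t|) / Real.cosh (Real.pi * t))
    rw [mul_zero, zero_mul] at hlim
    refine squeeze_zero_norm' ?_ hlim
    have hev : ∀ᶠ k : ℕ in Filter.atTop, 1 ≤ α * k + (b - α / 2) :=
      (Filter.tendsto_atTop_add_const_right _ _
        ((tendsto_natCast_atTop_atTop).const_mul_atTop hα)).eventually_ge_atTop 1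
    filter_upwards [hev] with N hN
    rw [← integral_const_mul]
    refine norm_integral_le_of_norm_le (hI.const_mul _) (ae_of_all _ fun t => ?_)
    have hre : (α * (N - 1 / 2 + t * Complex.I) + b : ℂ).re = α * N + (b - α / 2) := by
      simp; ring
    have him : (α * (N - 1 / 2 + t * Complex.I) + b : ℂ).im = α * t := by simp
    have h1 := Complex.norm_Gamma_inv_le_of_one_le_re
      (w := α * (N - 1 / 2 + t * Complex.I) + b) (by rw [hre]; exact hN)
    rw [hre, him, abs_mul, abs_of_pos hα] at h1
    have h2 := Complex.norm_exp_mul_le (N - 1 / 2) t ρ ψ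
    push_cast at h2
    have hG : 0 < Real.Gamma (α * N + (b - α / 2)) := Real.Gamma_pos_of_pos (by linarith)
    rw [norm_div, Complex.norm_real, Real.norm_eq_abs, abs_of_pos (Real.cosh_pos _),
      ← mul_div_assoc]
    have hcosh := (Real.cosh_pos (Real.pi * t)).le
    gcongr
    rw [hh, norm_mul, abs_of_pos hG]
    have e1 : Real.exp ((N - 1 / 2) * ρ) = Real.exp (-ρ / 2) * Real.exp ρ ^ N := by
      rw [← Real.exp_nat_mul, ← Real.exp_add]; ring_nf
    have e2 : Real.exp (|ψ| * |t|) * Real.exp (Real.pi * (α * |t|) / 2) ≤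
        Real.exp (a * |t|) := by
      rw [← Real.exp_add, ha]
      refine Real.exp_le_exp.2 ?_
      have : Real.pi / 2 * (α * |t|) ≤ c * (α * |t|) := by gcongr
      linarith
    calc _ ≤ _ := mul_le_mul h2 h1 (norm_nonneg _) (by positivity)
      _ = Real.exp ((N - 1 / 2) * ρ) * (Real.Gamma (α * N + (b - α / 2)))⁻¹ *
          (Real.exp (|ψ| * |t|) * Real.exp (Real.pi * (α * |t|) / 2)) := by ring
      _ ≤ Real.exp ((N - 1 / 2) * ρ) * (Real.Gamma (α * N + (b - α / 2)))⁻¹ *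
          Real.exp (a * |t|) := by gcongr
      _ = _ := by rw [e1]; ring
  have hE : 2 * mittagLeffler α b (-Complex.exp (ρ + ψ * Complex.I)) =
      ∫ t : ℝ, h (-1 / 2 + t * Complex.I) / (Real.cosh (Real.pi * t) : ℂ) := by
    have l1 := ((summable_mittagLeffler hα b
      (-Complex.exp (ρ + ψ * Complex.I))).hasSum.tendsto_sum_nat).const_mul 2
    simp only [hterm, hsum] at l1
    have l2 : Filter.Tendsto (fun N : ℕ => (-1 : ℂ) ^ N * ∫ t : ℝ,
        h (N - 1 / 2 + t * Complex.I) / (Real.cosh (Real.pi * t) : ℂ)) Filter.atTop (nhds 0) := by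
      rw [tendsto_zero_iff_norm_tendsto_zero] at htail ⊢
      simpa using htail
    have l3 := l2.const_sub (∫ t : ℝ, h (-1 / 2 + t * Complex.I) / (Real.cosh (Real.pi * t) : ℂ))
    rw [sub_zero] at l3
    simp only [mittagLeffler, hterm]
    exact tendsto_nhds_unique l1 l3
  have hn : ‖∫ t : ℝ, h (-1 / 2 + t * Complex.I) / (Real.cosh (Real.pi * t) : ℂ)‖ ≤
      Real.exp (-ρ / 2) * C * ∫ t : ℝ, Real.exp (a * |t|) / Real.cosh (Real.pi * t) := by
    rw [← integral_const_mul]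
    refine norm_integral_le_of_norm_le (hI.const_mul _) (ae_of_all _ fun t => ?_)
    have hcosh := (Real.cosh_pos (Real.pi * t)).le
    rw [norm_div, Complex.norm_real, Real.norm_eq_abs, abs_of_pos (Real.cosh_pos _),
      ← mul_div_assoc, mul_assoc]
    gcongr
    have := hCb (-1 / 2) t ρ (by norm_num [abs_of_pos])
    have e : (-1 / 2 * ρ : ℝ) = -ρ / 2 := by ring
    simpa [e, hh] using this
  rw [← hE, norm_mul, Complex.norm_ofNat] at hn
  linarith

/-- Boundedness of E_{α,b-α} on the ray suffices, since z E_{α,b} = E_{α,b-α} - 1/Γ(b-α). -/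
theorem exists_norm_mittagLeffler_le_exp_neg {α ψ : ℝ} (hα : 0 < α) (b : ℝ)
    (hψ : |ψ| + Real.pi * α / 2 < Real.pi) :
    ∃ K, ∀ ρ : ℝ, 0 ≤ ρ → ‖mittagLeffler α b (-Complex.exp (ρ + ψ * Complex.I))‖ ≤
      K * Real.exp (-ρ) := by
  obtain ⟨K, hK⟩ := exists_norm_mittagLeffler_le_exp_neg_half hα (b - α) hψ
  refine ⟨K + |Real.Gamma (b - α)|⁻¹, fun ρ hρ => ?_⟩
  set z := -Complex.exp (ρ + ψ * Complex.I) with hz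
  have hzn : ‖z‖ = Real.exp ρ := by rw [hz, norm_neg, Complex.norm_exp]; simp
  have h1 : z * mittagLeffler α b z =
      mittagLeffler α (b - α) z - ((Real.Gamma (b - α) : ℂ))⁻¹ := by
    rw [mittagLeffler_sub hα]; ring
  have hK0 : 0 ≤ K := nonneg_of_mul_nonneg_left ((norm_nonneg _).trans (hK 0)) (Real.exp_pos _)
  have h2 := congrArg norm h1
  rw [norm_mul, hzn] at h2
  have h3 : Real.exp ρ * ‖mittagLeffler α b z‖ ≤ K + |Real.Gamma (b - α)|⁻¹ := by
    rw [h2]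
    refine (norm_sub_le _ _).trans (add_le_add ((hK ρ).trans ?_) (by simp))
    exact mul_le_of_le_one_right hK0 (Real.exp_le_one_iff.2 (by linarith))
  rw [Real.exp_neg, ← div_eq_mul_inv, le_div_iff₀ (Real.exp_pos _), mul_comm]
  exact h3

/-- On a ray outside the sector `|arg z| ≤ πα/2`, the Mittag-Leffler function is `O(1 / |z|)`. -/
theorem exists_norm_mittagLeffler_ray_le {α β φ : ℝ} (hα : 0 < α)
    (hφ1 : -Real.pi < φ) (hφ2 : φ ≤ Real.pi) (hφ : Real.pi * α / 2 < |φ|) :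
    ∃ K, 0 ≤ K ∧ ∀ r : ℝ, 0 ≤ r → ‖mittagLeffler α β (Complex.exp (Complex.I * φ) * r)‖ ≤ K ∧
      (1 ≤ r → ‖mittagLeffler α β (Complex.exp (Complex.I * φ) * r)‖ ≤ K * r⁻¹) := by
  -- Measuring the angle from the negative axis, ψ = φ ∓ π, so |ψ| = π - |φ|.
  obtain ⟨ψ, hψ, hψφ⟩ : ∃ ψ : ℝ, |ψ| + Real.pi * α / 2 < Real.pi ∧
      Complex.exp (Complex.I * φ) = -Complex.exp (ψ * Complex.I) := by
    have hpos : 0 < Real.pi * α / 2 := by positivity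
    rcases le_or_gt 0 φ with h | h
    · refine ⟨φ - Real.pi, ?_, ?_⟩
      · rw [abs_of_nonneg h] at hφ
        rw [abs_of_nonpos (by linarith)]; linarith
      · push_cast
        rw [sub_mul, Complex.exp_sub_pi_mul_I, neg_neg, mul_comm]
    · refine ⟨φ + Real.pi, ?_, ?_⟩
      · rw [abs_of_neg h] at hφ
        rw [abs_of_nonneg (by linarith)]; linarith
      · push_cast
        rw [add_mul, Complex.exp_add_pi_mul_I, neg_neg, mul_comm]
  obtain ⟨K, hK⟩ := exists_norm_mittagLeffler_le_exp_neg hα β hψ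
  have hK0 : 0 ≤ K := nonneg_of_mul_nonneg_left ((norm_nonneg _).trans (hK 0 le_rfl))
    (Real.exp_pos _)
  -- The sum of the absolute coefficients bounds E on the unit disc.
  set M := ∑' k : ℕ, |Real.Gamma (α * k + β)|⁻¹ with hM
  have hMs : Summable fun k : ℕ => |Real.Gamma (α * k + β)|⁻¹ := by
    simpa using summable_pow_mul_Gamma_inv hα β (r := 1) zero_le_one
  have hM0 : 0 ≤ M := tsum_nonneg fun k => by positivity
  have hlarge (r : ℝ) (hr : 1 ≤ r) :
      ‖mittagLeffler α β (Complex.exp (Complex.I * φ) * r)‖ ≤ (K + M) * r⁻¹ := by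
    have hr0 : 0 < r := by linarith
    have := hK (Real.log r) (Real.log_nonneg hr)
    rw [Complex.exp_add, ← Complex.ofReal_exp, Real.exp_log hr0, Real.exp_neg,
      Real.exp_log hr0, ← mul_neg, ← hψφ, mul_comm (r : ℂ)] at this
    refine this.trans ?_
    gcongr
    linarith
  refine ⟨K + M, by positivity, fun r hr => ⟨?_, hlarge r⟩⟩
  rcases le_or_gt 1 r with h | h
  · refine (hlarge r h).trans (mul_le_of_le_one_right (by positivity) (inv_le_one_of_one_le₀ h))
  · refine le_trans ?_ (le_add_of_nonneg_left hK0)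
    refine tsum_of_norm_bounded hMs.hasSum fun k => ?_
    rw [norm_div, norm_pow, norm_mul, mul_comm Complex.I, Complex.norm_exp_ofReal_mul_I, one_mul,
      Complex.norm_real, Complex.norm_real, Real.norm_eq_abs, Real.norm_eq_abs, abs_of_nonneg hr,
      div_eq_mul_inv]
    exact mul_le_of_le_one_left (by positivity) (pow_le_one₀ hr h.le)

theorem measurable_mittagLeffler {α : ℝ} (hα : 0 < α) (b : ℝ) : Measurable (mittagLeffler α b) := by
  refine measurable_of_tendsto_metrizable
    (f := fun (N : ℕ) (z : ℂ) => ∑ k ∈ Finset.range N, z ^ k / (Real.Gamma (α * k + b) : ℂ))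
    (fun N => by fun_prop) ?_
  rw [tendsto_pi_nhds]
  exact fun z => (summable_mittagLeffler hα b z).hasSum.tendsto_sum_nat

/-! ### L^p bounds for the Plancherel transform. -/

section Fourier

variable {V : Type*} [NormedAddCommGroup V] [InnerProductSpace ℝ V] [FiniteDimensional ℝ V]
  [MeasurableSpace V] [BorelSpace V]

/-- On `L¹ ∩ L²`, the `L²` Fourier transform is given by the Fourier integral. -/
theorem fourier_toLp_ae_eq {f : V → ℂ} (h1 : Integrable f) (h2 : MemLp f 2) :
    (𝓕 (h2.toLp f) : Lp (α := V) ℂ 2 volume) =ᵐ[volume] 𝓕 f := by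
  have hcont : Continuous (𝓕 f) :=
    VectorFourier.fourierIntegral_continuous Real.continuous_fourierChar
      (innerSL ℝ).continuous₂ h1
  -- Test against smooth compactly supported functions: the transform moves onto the test function
  -- by definition for distributions, and by Fubini for the integral.
  refine ae_eq_of_integral_contDiff_smul_eq ((Lp.memLp _).locallyIntegrable (by norm_num))
    hcont.locallyIntegrable fun g hg hgc => ?_
  have hg₁ : HasCompactSupport (Complex.ofRealCLM ∘ g) := hgc.comp_left rfl
  have hg₂ : ContDiff ℝ ((⊤ : ℕ∞) : WithTop ℕ∞) (Complex.ofRealCLM ∘ g) :=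
    Complex.ofRealCLM.contDiff.comp hg
  set u : 𝓢(V, ℂ) := hg₁.toSchwartzMap hg₂ with hu
  have e1 : ∫ x, g x • (𝓕 (h2.toLp f) : Lp (α := V) ℂ 2 volume) x =
      ((𝓕 (h2.toLp f) : Lp (α := V) ℂ 2 volume) : 𝓢'(V, ℂ)) u := by simp [hu]
  rw [e1, ← Lp.fourier_toTemperedDistribution_eq, TemperedDistribution.fourier_apply,
    Lp.toTemperedDistribution_apply]
  have e2 : ∫ x, (𝓕 u) x • (h2.toLp f : V → ℂ) x = ∫ x, (𝓕 u) x • f x := by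
    refine integral_congr_ae ?_
    filter_upwards [h2.coeFn_toLp] with x hx
    rw [hx]
  have e3 : ∫ x, (𝓕 u) x • f x = ∫ x, u x • 𝓕 f x := by
    rw [SchwartzMap.fourier_coe]
    simpa using! VectorFourier.integral_fourierIntegral_smul_eq_flip (L := innerₗ V)
      Real.continuous_fourierChar continuous_inner u.integrable h1
  rw [e2, e3]
  simp [hu]

theorem enorm_fourier_toLp_le {f : V → ℂ} (h1 : Integrable f) (h2 : MemLp f 2) :
    ∀ᵐ ξ, ‖(𝓕 (h2.toLp f) : Lp (α := V) ℂ 2 volume) ξ‖ₑ ≤ ∫⁻ x, ‖f x‖ₑ := by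
  filter_upwards [fourier_toLp_ae_eq h1 h2] with ξ hξ
  rw [hξ, Real.fourier_eq]
  refine (enorm_integral_le_lintegral_enorm _).trans_eq (lintegral_congr fun x => ?_)
  rw [← ofReal_norm, Circle.norm_smul, ofReal_norm]

theorem eLpNorm_fourier_toLp {f : V → ℂ} (h2 : MemLp f 2) :
    eLpNorm (𝓕 (h2.toLp f) : Lp (α := V) ℂ 2 volume) 2 volume = eLpNorm f 2 volume := by
  have := Lp.norm_fourier_eq (h2.toLp f)
  rw [Lp.norm_def, Lp.norm_toLp] at this
  exact (ENNReal.toReal_eq_toReal_iff' (Lp.eLpNorm_ne_top _) h2.eLpNorm_ne_top).1 this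

/-- Pointwise, |g|^p ≤ M^{p-2}|g|². This elementary interpolation stands in for Hausdorff–Young. -/
theorem eLpNorm_le_of_ae_enorm_le {α E : Type*} {m : MeasurableSpace α} {μ : Measure α}
    [NormedAddCommGroup E] {g : α → E} {M : ℝ≥0∞} (hMt : M ≠ ∞)
    (hM : ∀ᵐ x ∂μ, ‖g x‖ₑ ≤ M) {p : ℝ≥0∞}
    (hp : 2 ≤ p) (hp' : p ≠ ∞) :
    eLpNorm g p μ ≤ (M ^ (p.toReal - 2) * eLpNorm g 2 μ ^ (2 : ℝ)) ^ (1 / p.toReal) := by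
  have hp2 : 2 ≤ p.toReal := by simpa using ENNReal.toReal_mono hp' hp
  have hp0 : p ≠ 0 := fun h => by simp [h] at hp
  rw [eLpNorm_eq_lintegral_rpow_enorm_toReal hp0 hp',
    eLpNorm_eq_lintegral_rpow_enorm_toReal (p := 2) (by simp) (by simp), ← ENNReal.rpow_mul]
  simp only [ENNReal.toReal_ofNat, one_div, inv_mul_cancel₀ (two_ne_zero' ℝ), ENNReal.rpow_one]
  gcongr
  calc ∫⁻ x, ‖g x‖ₑ ^ p.toReal ∂μ ≤ ∫⁻ x, M ^ (p.toReal - 2) * ‖g x‖ₑ ^ (2 : ℝ) ∂μ := by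
        refine lintegral_mono_ae ?_
        filter_upwards [hM] with x hx
        calc ‖g x‖ₑ ^ p.toReal = ‖g x‖ₑ ^ (p.toReal - 2) * ‖g x‖ₑ ^ (2 : ℝ) := by
              rw [← ENNReal.rpow_add_of_nonneg _ _ (by linarith) (by norm_num)]
              congr 1; ring
          _ ≤ _ := by gcongr
    _ ≤ _ := by
        rw [lintegral_const_mul' _ _ (ENNReal.rpow_ne_top_of_nonneg (by linarith) hMt)]

/-- Interpolation between `L¹ → L^∞` and `L² → L²` for bounded functions supported on a set of
finite measure. -/
theorem eLpNorm_fourier_indicator_le {f : V → ℂ} (hf : AEStronglyMeasurable f volume) {S : Set V}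
    (hS : MeasurableSet S) (hSf : volume S ≠ ∞) {b : ℝ} (hb : ∀ x ∈ S, ‖f x‖ ≤ b)
    (h2 : MemLp (S.indicator f) 2) {p : ℝ≥0∞} (hp : 2 ≤ p) (hp' : p ≠ ∞) :
    eLpNorm (𝓕 (h2.toLp _) : Lp (α := V) ℂ 2 volume) p volume ≤
      ENNReal.ofReal b * volume S ^ (1 - 1 / p.toReal) := by
  have hp2 : 2 ≤ p.toReal := by simpa using ENNReal.toReal_mono hp' hp
  have hpt : ∀ x, ‖S.indicator f x‖ₑ ≤ S.indicator (fun _ => ENNReal.ofReal b) x := fun x => by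
    by_cases hx : x ∈ S
    · simp only [Set.indicator_of_mem hx, ← ofReal_norm]
      exact ENNReal.ofReal_le_ofReal (hb x hx)
    · simp [hx]
  have h1 : Integrable (S.indicator f) := by
    rw [integrable_indicator_iff hS]
    exact Measure.integrableOn_of_bounded hSf hf
      ((ae_restrict_iff' hS).2 (ae_of_all _ hb))
  have hL1 : ∫⁻ x, ‖S.indicator f x‖ₑ ≤ ENNReal.ofReal b * volume S :=
    (lintegral_mono hpt).trans_eq (by rw [lintegral_indicator_const hS])
  have hL2 : eLpNorm (S.indicator f) 2 volume ^ (2 : ℝ) ≤ ENNReal.ofReal b ^ (2 : ℝ) * volume S := by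
    rw [eLpNorm_eq_lintegral_rpow_enorm_toReal (p := 2) (by simp) (by simp), ← ENNReal.rpow_mul]
    simp only [ENNReal.toReal_ofNat, one_div, inv_mul_cancel₀ (two_ne_zero' ℝ), ENNReal.rpow_one]
    rw [← lintegral_indicator_const hS]
    refine lintegral_mono fun x => ?_
    by_cases hx : x ∈ S
    · have := hpt x
      simp only [Set.indicator_of_mem hx] at this ⊢
      gcongr
    · simp [hx]
  have hbd := eLpNorm_le_of_ae_enorm_le (ENNReal.mul_ne_top ENNReal.ofReal_ne_top hSf)
    ((enorm_fourier_toLp_le h1 h2).mono fun x hx => hx.trans hL1) hp hp'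
  rw [eLpNorm_fourier_toLp] at hbd
  refine hbd.trans ?_
  have hq : 0 ≤ p.toReal - 2 := by linarith
  calc _ ≤ ((ENNReal.ofReal b * volume S) ^ (p.toReal - 2) *
        (ENNReal.ofReal b ^ (2 : ℝ) * volume S)) ^ (1 / p.toReal) := by gcongr
    _ = (ENNReal.ofReal b ^ p.toReal * volume S ^ (p.toReal - 1)) ^ (1 / p.toReal) := by
        congr 1
        rw [ENNReal.mul_rpow_of_nonneg _ _ hq, mul_mul_mul_comm,
          ← ENNReal.rpow_add_of_nonneg _ _ hq (by norm_num)]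
        nth_rewrite 2 [← ENNReal.rpow_one (volume S)]
        rw [← ENNReal.rpow_add_of_nonneg _ _ hq (by norm_num)]
        congr 2 <;> ring
    _ = _ := by
        rw [ENNReal.mul_rpow_of_nonneg _ _ (by positivity), ← ENNReal.rpow_mul,
          ← ENNReal.rpow_mul]
        have h0 : p.toReal ≠ 0 := by linarith
        rw [mul_one_div_cancel h0, ENNReal.rpow_one, sub_mul, mul_one_div_cancel h0, one_mul]

theorem tendsto_toLp_indicator_ball {f : V → ℂ} (hf : MemLp f 2) {R : ℕ → ℝ}
    (hR : Filter.Tendsto R Filter.atTop Filter.atTop) :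
    Filter.Tendsto (fun N => (hf.indicator (measurableSet_ball (x := (0 : V)) (ε := R N))).toLp _)
      Filter.atTop (nhds (hf.toLp f)) := by
  rw [Lp.tendsto_Lp_iff_tendsto_eLpNorm'']
  simp only [eLpNorm_eq_lintegral_rpow_enorm_toReal (p := 2) (by simp) (by simp)]
  have h0 : (0 : ℝ≥0∞) = (∫⁻ _ : V, 0) ^ (1 / (2 : ℝ≥0∞).toReal) := by simp
  rw [h0]
  refine (ENNReal.continuous_rpow_const.tendsto _).comp ?_
  have hfin := (lintegral_rpow_enorm_lt_top_of_eLpNorm_lt_top (by simp) (by simp) hf.2).ne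
  refine tendsto_lintegral_of_dominated_convergence' (fun x => ‖f x‖ₑ ^ (2 : ℝ≥0∞).toReal)
    (fun N => ?_) (fun N => ae_of_all _ fun x => ?_) hfin (ae_of_all _ fun x => ?_)
  · exact (((hf.indicator measurableSet_ball).1.sub hf.1).enorm).pow_const _
  · refine ENNReal.rpow_le_rpow ?_ (by simp)
    by_cases hx : x ∈ Metric.ball (0 : V) (R N) <;> simp [hx]
  · refine tendsto_const_nhds.congr' ?_
    filter_upwards [hR.eventually_gt_atTop ‖x‖] with N hN
    simp [hN]

/-- Dyadic decomposition: the annulus |x| ~ 2^N contributes O(2^{N(dθ-σ)}) with θ = 1 - 1/p, a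
convergent geometric series. -/
theorem memLp_fourier_toLp_of_norm_le {f : V → ℂ} (hf : MemLp f 2) {C σ : ℝ}
    (hb : ∀ x, ‖f x‖ ≤ C * (1 + ‖x‖) ^ (-σ)) {p : ℝ≥0∞} (hp : 2 ≤ p) (hp' : p ≠ ∞)
    (hσ : Module.finrank ℝ V * (1 - 1 / p.toReal) < σ) :
    MemLp (𝓕 (hf.toLp f) : Lp (α := V) ℂ 2 volume) p := by
  refine ⟨Lp.aestronglyMeasurable _, ?_⟩
  have hp2 : 2 ≤ p.toReal := by simpa using ENNReal.toReal_mono hp' hp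
  set θ := 1 - 1 / p.toReal with hθ
  have hθ0 : 0 ≤ θ := by
    rw [hθ, sub_nonneg, div_le_one (by linarith)]; linarith
  set d := Module.finrank ℝ V with hd
  have hσ0 : 0 < σ := lt_of_le_of_lt (by positivity) hσ
  have hC : 0 ≤ C := by simpa using (norm_nonneg _).trans (hb 0)
  let F : ℕ → Lp (α := V) ℂ 2 volume := fun N =>
    (hf.indicator (measurableSet_ball (x := (0 : V)) (ε := 2 ^ N))).toLp _
  let A : ℕ → Set V := fun N => Metric.ball 0 (2 ^ (N + 1)) \ Metric.ball 0 (2 ^ N)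
  have hA (N : ℕ) : MeasurableSet (A N) := measurableSet_ball.diff measurableSet_ball
  let D : ℕ → Lp (α := V) ℂ 2 volume := fun N => (hf.indicator (hA N)).toLp _
  have hFD (N : ℕ) : F (N + 1) = F N + D N := by
    simp only [F, D, ← MemLp.toLp_add]
    congr 1
    have hdisj : Disjoint (Metric.ball (0 : V) (2 ^ N)) (A N) := Set.disjoint_sdiff_right
    have hun : Metric.ball (0 : V) (2 ^ (N + 1)) = Metric.ball 0 (2 ^ N) ∪ A N :=
      (Set.union_sdiff_cancel
        (Metric.ball_subset_ball (pow_le_pow_right₀ one_le_two (Nat.le_succ N)))).symm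
    rw [hun, Set.indicator_union_of_disjoint hdisj]
    rfl
  set c := volume (Metric.ball (0 : V) 1) with hc
  have hcf : c ≠ ∞ := measure_ball_lt_top.ne
  set K : ℝ≥0∞ := ENNReal.ofReal (C * 2 ^ (d * θ)) * c ^ θ with hK
  have hKf : K ≠ ∞ :=
    ENNReal.mul_ne_top ENNReal.ofReal_ne_top (ENNReal.rpow_ne_top_of_nonneg hθ0 hcf)
  set ρ : ℝ := 2 ^ (d * θ - σ) with hρ
  have hρ1 : ENNReal.ofReal ρ < 1 := by
    rw [ENNReal.ofReal_lt_one]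
    exact Real.rpow_lt_one_of_one_lt_of_neg one_lt_two (by linarith)
  have hD (N : ℕ) : eLpNorm (𝓕 (D N) : Lp (α := V) ℂ 2 volume) p volume ≤ K * ENNReal.ofReal ρ ^ N := by
    have hvol : volume (A N) ≤ ENNReal.ofReal ((2 ^ (N + 1)) ^ d) * c := by
      rw [hc, ← Measure.addHaar_ball_of_pos volume 0 (by positivity)]
      exact measure_mono Set.sdiff_subset
    have hbN : ∀ x ∈ A N, ‖f x‖ ≤ C * (2 ^ N) ^ (-σ) := fun x hx => by
      refine (hb x).trans (mul_le_mul_of_nonneg_left ?_ hC)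
      have : (2 : ℝ) ^ N ≤ ‖x‖ := by simpa using hx.2
      exact Real.rpow_le_rpow_of_nonpos (by positivity) (by linarith) (by linarith)
    refine (eLpNorm_fourier_indicator_le hf.1 (hA N) (ne_top_of_le_ne_top
      (ENNReal.mul_ne_top ENNReal.ofReal_ne_top hcf) hvol) hbN _ hp hp').trans ?_
    calc _ ≤ ENNReal.ofReal (C * (2 ^ N) ^ (-σ)) *
          (ENNReal.ofReal ((2 ^ (N + 1)) ^ d) * c) ^ θ := by gcongr
      _ = ENNReal.ofReal (C * (2 ^ N) ^ (-σ) * ((2 ^ (N + 1)) ^ d) ^ θ) * c ^ θ := by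
          rw [ENNReal.mul_rpow_of_nonneg _ _ hθ0,
            ENNReal.ofReal_rpow_of_nonneg (by positivity) hθ0, ← mul_assoc,
            ← ENNReal.ofReal_mul (by positivity)]
      _ = ENNReal.ofReal (C * 2 ^ (d * θ) * ρ ^ N) * c ^ θ := by
          congr 2
          have e : ((2 : ℝ) ^ N) ^ (-σ) * ((2 ^ (N + 1)) ^ d) ^ θ = 2 ^ (d * θ) * ρ ^ N := by
            rw [hρ]
            simp only [← Real.rpow_natCast, ← Real.rpow_mul zero_le_two]
            rw [← Real.rpow_add two_pos, ← Real.rpow_add two_pos]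
            congr 1
            push_cast
            ring
          rw [mul_assoc, e, mul_assoc]
      _ = _ := by
          rw [ENNReal.ofReal_mul (by positivity), ENNReal.ofReal_pow (by positivity), hK]
          ring
  set B : ℝ≥0∞ := ENNReal.ofReal C * c ^ θ + ∑' N, K * ENNReal.ofReal ρ ^ N with hB
  have hBf : B < ∞ := by
    rw [hB, ENNReal.tsum_mul_left, ENNReal.tsum_geometric]
    refine ENNReal.add_lt_top.2 ⟨(ENNReal.mul_ne_top ENNReal.ofReal_ne_top
      (ENNReal.rpow_ne_top_of_nonneg hθ0 hcf)).lt_top, (ENNReal.mul_ne_top hKf ?_).lt_top⟩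
    exact ENNReal.inv_ne_top.2 (tsub_pos_of_lt hρ1).ne'
  have hsum (N : ℕ) : eLpNorm (𝓕 (F N) : Lp (α := V) ℂ 2 volume) p volume ≤
      ENNReal.ofReal C * c ^ θ + ∑ j ∈ Finset.range N, K * ENNReal.ofReal ρ ^ j := by
    induction N with
    | zero =>
      have h := eLpNorm_fourier_indicator_le hf.1 (measurableSet_ball (x := (0 : V)) (ε := 2 ^ 0))
        measure_ball_lt_top.ne (b := C) (fun x _ => (hb x).trans (mul_le_of_le_one_right hC
          (Real.rpow_le_one_of_one_le_of_nonpos (by simp) (by linarith))))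
        (hf.indicator measurableSet_ball) hp hp'
      refine h.trans ?_
      simp [hc, hθ]
    | succ N ih =>
      rw [hFD, FourierTransform.fourier_add, eLpNorm_congr_ae (Lp.coeFn_add _ _),
        Finset.sum_range_succ, ← add_assoc]
      refine (eLpNorm_add_le (Lp.aestronglyMeasurable _) (Lp.aestronglyMeasurable _)
        (one_le_two.trans hp)).trans (add_le_add ih (hD N))
  have hlim : Filter.Tendsto (fun N => (𝓕 (F N) : Lp (α := V) ℂ 2 volume)) Filter.atTop
      (nhds (𝓕 (hf.toLp f))) :=
    (FourierTransform.continuous_fourier.tendsto _).comp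
      (tendsto_toLp_indicator_ball hf (tendsto_pow_atTop_atTop_of_one_lt one_lt_two))
  -- L² convergence gives an a.e. convergent subsequence, and Fatou carries the uniform L^p bound to
  -- the limit.
  obtain ⟨ns, -, hns⟩ := (tendstoInMeasure_of_tendsto_Lp hlim).exists_seq_tendsto_ae
  refine lt_of_le_of_lt (Lp.eLpNorm_lim_le_liminf_eLpNorm
    (fun N => Lp.aestronglyMeasurable (𝓕 (F (ns N)))) _ hns) (lt_of_le_of_lt ?_ hBf)
  refine (Filter.liminf_le_liminf (v := fun _ => B) (Filter.Eventually.of_forall fun N => ?_)).trans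
    (by simp)
  exact (hsum (ns N)).trans (by rw [hB]; gcongr; exact ENNReal.sum_le_tsum _)

end Fourier

/-! ### From L² classes to tempered distributions. -/

theorem isGivenByFunction_toTemperedDistribution {n : ℕ}
    (F : Lp (α := EuclideanSpace ℝ (Fin n)) ℂ 2) {f : EuclideanSpace ℝ (Fin n) → ℂ}
    (hf : F =ᵐ[volume] f) : IsGivenByFunction (F : 𝓢'(EuclideanSpace ℝ (Fin n), ℂ)) f := by
  intro u
  refine ⟨?_, ?_⟩
  · have hf2 : MemLp f 2 := (memLp_congr_ae hf).1 (Lp.memLp F)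
    exact (u.memLp 2).integrable_mul hf2
  · rw [Lp.toTemperedDistribution_apply]
    refine integral_congr_ae ?_
    filter_upwards [hf] with x hx
    rw [hx]

theorem fourierTransformMemLp_of_memLp_fourier {n : ℕ} {f : EuclideanSpace ℝ (Fin n) → ℂ}
    (hf : MemLp f 2) {p : ℝ≥0∞}
    (h : MemLp (𝓕 (hf.toLp f) : Lp (α := EuclideanSpace ℝ (Fin n)) ℂ 2) p) :
    FourierTransformMemLp f p := by
  refine ⟨(hf.toLp f : Lp (α := EuclideanSpace ℝ (Fin n)) ℂ 2),
    isGivenByFunction_toTemperedDistribution _ hf.coeFn_toLp, _, ?_, h⟩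
  rw [Lp.fourier_toTemperedDistribution_eq]
  exact isGivenByFunction_toTemperedDistribution _ Filter.EventuallyEq.rfl

/-! ### Consequences of polynomial decay, and the theorem. -/

section Decay

variable {V : Type*} [NormedAddCommGroup V] [InnerProductSpace ℝ V] [FiniteDimensional ℝ V]
  [MeasurableSpace V] [BorelSpace V]

theorem memLp_two_of_norm_le {f : V → ℂ} (hf : AEStronglyMeasurable f volume) {C σ : ℝ}
    (hb : ∀ x, ‖f x‖ ≤ C * (1 + ‖x‖) ^ (-σ)) (hσ : Module.finrank ℝ V < 2 * σ) :
    MemLp f 2 := by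
  rw [memLp_two_iff_integrable_sq_norm hf]
  refine ((integrable_one_add_norm hσ).const_mul (C ^ 2)).mono' (hf.norm.pow 2)
    (ae_of_all _ fun x => ?_)
  rw [Real.norm_eq_abs, abs_of_nonneg (by positivity)]
  calc ‖f x‖ ^ 2 ≤ (C * (1 + ‖x‖) ^ (-σ)) ^ 2 := by gcongr; exact hb x
    _ = C ^ 2 * (1 + ‖x‖) ^ (-(2 * σ)) := by
      rw [mul_pow, ← Real.rpow_natCast ((1 + ‖x‖) ^ (-σ)) 2, ← Real.rpow_mul (by positivity)]
      congr 2; push_cast; ring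

theorem memLp_top_fourier_toLp_of_norm_le {f : V → ℂ} (hf : MemLp f 2) {C σ : ℝ}
    (hb : ∀ x, ‖f x‖ ≤ C * (1 + ‖x‖) ^ (-σ)) (hσ : Module.finrank ℝ V < σ) :
    MemLp (𝓕 (hf.toLp f) : Lp (α := V) ℂ 2 volume) ∞ := by
  have h1 : Integrable f := ((integrable_one_add_norm hσ).const_mul C).mono' hf.1 (ae_of_all _ hb)
  refine ⟨Lp.aestronglyMeasurable _, ?_⟩
  rw [eLpNorm_exponent_top]
  exact (essSup_le_of_ae_le _ (enorm_fourier_toLp_le h1 hf)).trans_lt h1.2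

end Decay

theorem exists_norm_mittagLefflerRadial_le (n : ℕ) {α β φ σ : ℝ} (hα : 0 < α)
    (hφ1 : -Real.pi < φ) (hφ2 : φ ≤ Real.pi) (hφ : Real.pi * α / 2 < |φ|) (hσ : 0 < σ) :
    ∃ C, ∀ x, ‖mittagLefflerRadial n α β φ σ x‖ ≤ C * (1 + ‖x‖) ^ (-σ) := by
  obtain ⟨K, hK0, hK⟩ := exists_norm_mittagLeffler_ray_le (β := β) hα hφ1 hφ2 hφ
  -- The factor 2^σ comes from 1 + |x| ≤ 2 max(1, |x|).
  refine ⟨K * 2 ^ σ, fun x => ?_⟩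
  have h := hK (‖x‖ ^ σ) (by positivity)
  have hpos : 0 < 1 + ‖x‖ := by positivity
  rw [mul_assoc, Real.rpow_neg hpos.le, ← div_eq_mul_inv, ← Real.div_rpow zero_le_two hpos.le]
  rcases le_or_gt 1 ‖x‖ with hx | hx
  · refine (h.2 (Real.one_le_rpow hx hσ.le)).trans ?_
    rw [← Real.inv_rpow (norm_nonneg x)]
    gcongr
    rw [inv_eq_one_div, div_le_div_iff₀ (by linarith) hpos]
    linarith
  · refine h.1.trans (le_mul_of_one_le_right hK0 (Real.one_le_rpow ?_ hσ.le))
    rw [le_div_iff₀ hpos]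
    linarith

theorem measurable_mittagLefflerRadial (n : ℕ) {α : ℝ} (hα : 0 < α) (β φ σ : ℝ) :
    Measurable (mittagLefflerRadial n α β φ σ) :=
  (measurable_mittagLeffler hα β).comp
    ((Complex.measurable_ofReal.comp (measurable_norm.pow_const σ)).const_mul _)

theorem theorem1 (n : ℕ) (hn : 1 ≤ n) (α β φ σ : ℝ)
    (hα0 : 0 < α) (hα2 : α < 2) (hβ : 0 < β)
    (hφ1 : -Real.pi < φ) (hφ2 : φ ≤ Real.pi) (hφ : Real.pi * α / 2 < |φ|) :
    ((n : ℝ) < σ → ∀ p : ℝ≥0∞, 2 ≤ p →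
      FourierTransformMemLp (mittagLefflerRadial n α β φ σ) p) ∧
    (σ = (n : ℝ) → ∀ p : ℝ≥0∞, 2 ≤ p → p < ∞ →
      FourierTransformMemLp (mittagLefflerRadial n α β φ σ) p) ∧
    ((n : ℝ) / 2 < σ → σ < (n : ℝ) → ∀ p : ℝ≥0∞, 2 ≤ p →
      p < ENNReal.ofReal ((n : ℝ) / ((n : ℝ) - σ)) →
      FourierTransformMemLp (mittagLefflerRadial n α β φ σ) p) := by
  have hn0 : (1 : ℝ) ≤ n := by exact_mod_cast hn
  have hmeas := (measurable_mittagLefflerRadial n hα0 β φ σ).aestronglyMeasurable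
    (μ := (volume : Measure (EuclideanSpace ℝ (Fin n))))
  have hfin : (Module.finrank ℝ (EuclideanSpace ℝ (Fin n)) : ℝ) = n := by simp
  have finite_exponent (hσ : (n : ℝ) / 2 < σ) (p : ℝ≥0∞) (hp : 2 ≤ p) (hp' : p ≠ ∞)
      (h : n * (1 - 1 / p.toReal) < σ) :
      FourierTransformMemLp (mittagLefflerRadial n α β φ σ) p := by
    obtain ⟨C, hC⟩ := exists_norm_mittagLefflerRadial_le n (β := β) (σ := σ) hα0 hφ1 hφ2 hφ
      (by linarith)
    exact fourierTransformMemLp_of_memLp_fourier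
      (memLp_two_of_norm_le hmeas hC (by rw [hfin]; linarith))
      (memLp_fourier_toLp_of_norm_le _ hC hp hp' (by rwa [hfin]))
  have htoReal {p : ℝ≥0∞} (hp : 2 ≤ p) (hp' : p ≠ ∞) : 2 ≤ p.toReal := by
    simpa using ENNReal.toReal_mono hp' hp
  have hlt {p : ℝ≥0∞} (hp : 2 ≤ p) (hp' : p ≠ ∞) : n * (1 - 1 / p.toReal) < n := by
    have : 0 < 1 / p.toReal := one_div_pos.2 (by linarith [htoReal hp hp'])
    nlinarith
  refine ⟨fun hσ p hp => ?_, fun hσ p hp hp' => ?_, fun hσ hσn p hp hp' => ?_⟩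
  · rcases eq_or_ne p ∞ with rfl | hp'
    · obtain ⟨C, hC⟩ := exists_norm_mittagLefflerRadial_le n (β := β) (σ := σ) hα0 hφ1 hφ2 hφ
        (by linarith)
      exact fourierTransformMemLp_of_memLp_fourier
        (memLp_two_of_norm_le hmeas hC (by rw [hfin]; linarith))
        (memLp_top_fourier_toLp_of_norm_le _ hC (by rwa [hfin]))
    · exact finite_exponent (by linarith) p hp hp' ((hlt hp hp').trans hσ)
  · exact finite_exponent (by linarith) p hp hp'.ne (by rw [hσ]; exact hlt hp hp'.ne)
  · have hp'' : p ≠ ∞ := (hp'.trans ENNReal.ofReal_lt_top).ne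
    have h2 := htoReal hp hp''
    refine finite_exponent hσ p hp hp'' ?_
    have hlt' : p.toReal < n / (n - σ) := (ENNReal.lt_ofReal_iff_toReal_lt hp'').1 hp'
    rw [lt_div_iff₀ (by linarith)] at hlt'
    have hp0 : 0 < p.toReal := by linarith
    -- This rearranges p < n/(n-σ) into n(1-1/p) < σ, the summability condition.
    have : n - σ < n / p.toReal := by rw [lt_div_iff₀ hp0]; linarith
    rw [mul_sub, mul_one, mul_one_div]
    linarith
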